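/- A \emph{space of distributions} on $\mathbb{R}^d$ is a linear subspace of $\mathcal{D}'(\mathbb{R}^d)$ (complex-valued distributions) endowed with a locally convex topology which is finer than the one induced by $\mathcal{D}'(\mathbb{R}^d)$. The symbol $\hookrightarrow$ denotes a continuous injection; between spaces of distributions on the same $\mathbb{R}^d$ it denotes the inclusion map, assumed to be defined and continuous. The tensor product of $S,T\in\mathcal{D}'(\mathbb{R}^n)$ is the distribution $S\otimes T\in\mathcal{D}'(\mathbb{R}^{2n})$ characterised by $\langle S\otimes T,\varphi\otimes\psi\rangle=\langle S,\varphi\rangle\langle T,\psi\rangle$ for all $\varphi,\psi\in\mathcal{D}(\mathbb{R}^n)$. By $\widehat\otimes_\pi$ and $\widehat\otimes_\varepsilon$ we denote the completed projective and injective tensor products of locally convex spaces. Let $\mathcal{L}$, $E=E_x=E_y$ and $\mathcal{H}=\mathcal{H}_z=\mathcal{H}_x$ be spaces of distributions on $\mathbb{R}^n$, and let $E_{xy}$ and $\mathcal{H}_{zx}$ be spaces of distributions on $\mathbb{R}^{2n}=\mathbb{R}^n\times\mathbb{R}^n$. Assume that 1. $\mathcal{L}\hookrightarrow E\hookrightarrow\mathcal{H}$;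 2. $\mathcal{L}$ is nuclear and complete; 3. $E$ and $E_{xy}$ are complete; 4. the tensor product of distributions defines a continuous bilinear map $E_x\times E_y\to E_{xy}$, $(S,T)\mapsto S\otimes T$; 5. $\mathcal{H}_z\,\widehat\otimes_\varepsilon\,\mathcal{H}_x\cong\mathcal{H}_{zx}$, i.e. there is an isomorphism of topological vector spaces $\mathcal{H}_z\,\widehat\otimes_\varepsilon\,\mathcal{H}_x\to\mathcal{H}_{zx}$ sending each $S\otimes T$ to the distribution $S\otimes T$. Then $\mathcal{L}_x\,\widehat\otimes\,E_y\hookrightarrow E_{xy}$: there is a continuous linear injection $\mathcal{L}_x\,\widehat\otimes_\pi\,E_y\to E_{xy}$ sending each $S\otimes T$ ($S\in\mathcal{L}$, $T\in E$) to the distribution $S\otimes T$. (As $\mathcal{L}$ is nuclear, $\widehat\otimes_\pi$ and $\widehat\otimes_\varepsilon$ agree on $\mathcal{L}_x\otimes E_y$.) -/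

import Mathlib

open TopologicalSpace UniformSpace
open scoped Distributions TensorProduct

noncomputable section

/-! ### Locally convex structures defined by families of seminorms -/

/-- The uniform structure generated by a family of seminorms. -/
@[reducible]
def seminormUniformSpace {V ι : Type*} [AddCommGroup V] [Module ℂ V]
    (p : SeminormFamily ℂ V ι) : UniformSpace V :=
  ⨅ i, (p i).toSeminormedAddCommGroup.toUniformSpace

theorem seminormUniformSpace_isUniformAddGroup {V ι : Type*} [AddCommGroup V] [Module ℂ V]
    (p : SeminormFamily ℂ V ι) : @IsUniformAddGroup V (seminormUniformSpace p) _ :=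
  isUniformAddGroup_iInf fun i => (p i).toSeminormedAddCommGroup.to_isUniformAddGroup

theorem seminormUniformSpace_withSeminorms {V ι : Type*} [AddCommGroup V] [Module ℂ V]
    (p : SeminormFamily ℂ V ι) :
    @WithSeminorms ℂ V ι _ _ _ p (seminormUniformSpace p).toTopologicalSpace := by
  let _ : UniformSpace V := seminormUniformSpace p
  have _ : IsUniformAddGroup V := seminormUniformSpace_isUniformAddGroup p
  exact p.withSeminorms_iff_uniformSpace_eq_iInf.2 rfl

/-! ### The projective (`π`) topology on `V ⊗ W` and the completion `V ⊗̂_π W` -/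

section Projective

variable (V W : Type*) [AddCommGroup V] [Module ℂ V] [TopologicalSpace V]
  [AddCommGroup W] [Module ℂ W] [TopologicalSpace W]

/-- The algebraic tensor product `V ⊗ W`, to be endowed with the projective topology. -/
def ProjTensor (V W : Type*) [AddCommGroup V] [Module ℂ V] [AddCommGroup W] [Module ℂ W] : Type _ :=
  V ⊗[ℂ] W

instance (V W : Type*) [AddCommGroup V] [Module ℂ V] [AddCommGroup W] [Module ℂ W] :
    AddCommGroup (ProjTensor V W) := inferInstanceAs (AddCommGroup (V ⊗[ℂ] W))

instance (V W : Type*) [AddCommGroup V] [Module ℂ V] [AddCommGroup W] [Module ℂ W] :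
    Module ℂ (ProjTensor V W) := inferInstanceAs (Module ℂ (V ⊗[ℂ] W))

/-- The canonical bilinear map `V × W → V ⊗_π W`. -/
def ProjTensor.mk (V W : Type*) [AddCommGroup V] [Module ℂ V] [AddCommGroup W] [Module ℂ W] :
    V →ₗ[ℂ] W →ₗ[ℂ] ProjTensor V W := TensorProduct.mk ℂ V W

/-- All seminorms `r` on `V ⊗ W` for which `(v, w) ↦ r (v ⊗ w)` is continuous. They generate the
projective topology: the finest locally convex topology on `V ⊗ W` for which the canonical bilinear
map `V × W → V ⊗ W` is continuous. -/
def projSeminorms :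
    SeminormFamily ℂ (ProjTensor V W)
      {r : Seminorm ℂ (ProjTensor V W) //
        Continuous fun z : V × W => r (ProjTensor.mk V W z.1 z.2)} :=
  fun r => r.1

instance : UniformSpace (ProjTensor V W) := seminormUniformSpace (projSeminorms V W)

instance : IsUniformAddGroup (ProjTensor V W) :=
  seminormUniformSpace_isUniformAddGroup (projSeminorms V W)

theorem ProjTensor.withSeminorms : WithSeminorms (projSeminorms V W) :=
  seminormUniformSpace_withSeminorms (projSeminorms V W)

instance : ContinuousSMul ℂ (ProjTensor V W) := (ProjTensor.withSeminorms V W).continuousSMul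

instance : UniformContinuousConstSMul ℂ (ProjTensor V W) :=
  uniformContinuousConstSMul_of_continuousConstSMul ℂ _

/-- The completed projective tensor product `V ⊗̂_π W`. -/
abbrev CompletedProjTensor : Type _ := Completion (ProjTensor V W)

variable {V W} in
/-- The element `v ⊗ w` of `V ⊗̂_π W`. -/
def CompletedProjTensor.tmul (v : V) (w : W) : CompletedProjTensor V W :=
  ((ProjTensor.mk V W v w : ProjTensor V W) : Completion (ProjTensor V W))

end Projective

/-! ### The injective (`ε`) topology on `V ⊗ W` and the completion `V ⊗̂_ε W` -/

section Injective

variable (V W : Type*) [AddCommGroup V] [Module ℂ V] [TopologicalSpace V]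
  [AddCommGroup W] [Module ℂ W] [TopologicalSpace W]

/-- The algebraic tensor product `V ⊗ W`, to be endowed with the injective topology. -/
def InjTensor (V W : Type*) [AddCommGroup V] [Module ℂ V] [AddCommGroup W] [Module ℂ W] : Type _ :=
  V ⊗[ℂ] W

instance (V W : Type*) [AddCommGroup V] [Module ℂ V] [AddCommGroup W] [Module ℂ W] :
    AddCommGroup (InjTensor V W) := inferInstanceAs (AddCommGroup (V ⊗[ℂ] W))

instance (V W : Type*) [AddCommGroup V] [Module ℂ V] [AddCommGroup W] [Module ℂ W] :
    Module ℂ (InjTensor V W) := inferInstanceAs (Module ℂ (V ⊗[ℂ] W))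

/-- The canonical bilinear map `V × W → V ⊗_ε W`. -/
def InjTensor.mk (V W : Type*) [AddCommGroup V] [Module ℂ V] [AddCommGroup W] [Module ℂ W] :
    V →ₗ[ℂ] W →ₗ[ℂ] InjTensor V W := TensorProduct.mk ℂ V W

variable {V W} in
/-- The linear form `f ⊗ g` on `V ⊗ W`, with `(f ⊗ g) (v ⊗ w) = f v * g w`. -/
def InjTensor.form (f : V →ₗ[ℂ] ℂ) (g : W →ₗ[ℂ] ℂ) : InjTensor V W →ₗ[ℂ] ℂ :=
  TensorProduct.lift ((LinearMap.mul ℂ ℂ).compl₁₂ f g)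

/-- The polar of the unit ball of a seminorm `p`: the linear forms `f` with `|f| ≤ p`. When `p`
ranges over the continuous seminorms, these are the basic equicontinuous subsets of the dual. -/
def Seminorm.dualBall {V : Type*} [AddCommGroup V] [Module ℂ V] (p : Seminorm ℂ V) :
    Set (V →ₗ[ℂ] ℂ) := {f | ∀ v, ‖f v‖ ≤ p v}

variable {V W} in
/-- The seminorm `u ↦ sup {|(f ⊗ g) u| : |f| ≤ p, |g| ≤ q}` on `V ⊗ W`. -/
def injSeminorm (p : Seminorm ℂ V) (q : Seminorm ℂ W) : Seminorm ℂ (InjTensor V W) :=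
  ⨆ z : p.dualBall × q.dualBall,
    (normSeminorm ℂ ℂ).comp (InjTensor.form (z.1 : V →ₗ[ℂ] ℂ) (z.2 : W →ₗ[ℂ] ℂ))

/-- The supremum defining `injSeminorm` is finite. -/
theorem injSeminorm_bddAbove {V W : Type*} [AddCommGroup V] [Module ℂ V]
    [AddCommGroup W] [Module ℂ W] (p : Seminorm ℂ V) (q : Seminorm ℂ W) :
    BddAbove (Set.range fun z : p.dualBall × q.dualBall =>
      (normSeminorm ℂ ℂ).comp
        (InjTensor.form (z.1 : V →ₗ[ℂ] ℂ) (z.2 : W →ₗ[ℂ] ℂ))) := by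
  rw [Seminorm.bddAbove_range_iff]
  intro u
  change V ⊗[ℂ] W at u
  induction u using TensorProduct.induction_on with
  | zero =>
    refine ⟨0, ?_⟩
    rintro _ ⟨z, rfl⟩
    exact (map_zero ((normSeminorm ℂ ℂ).comp
      (InjTensor.form (z.1 : V →ₗ[ℂ] ℂ) (z.2 : W →ₗ[ℂ] ℂ)))).le
  | tmul v w =>
    refine ⟨p v * q w, ?_⟩
    rintro _ ⟨z, rfl⟩
    change ‖(z.1 : V →ₗ[ℂ] ℂ) v * (z.2 : W →ₗ[ℂ] ℂ) w‖ ≤ _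
    rw [norm_mul]
    exact mul_le_mul (z.1.2 v) (z.2.2 w) (norm_nonneg _) (apply_nonneg p v)
  | add a b ha hb =>
    obtain ⟨A, hA⟩ := ha
    obtain ⟨B, hB⟩ := hb
    refine ⟨A + B, ?_⟩
    rintro _ ⟨z, rfl⟩
    exact (map_add_le_add ((normSeminorm ℂ ℂ).comp
      (InjTensor.form (z.1 : V →ₗ[ℂ] ℂ) (z.2 : W →ₗ[ℂ] ℂ))) _ _).trans
      (add_le_add (hA ⟨z, rfl⟩) (hB ⟨z, rfl⟩))

theorem injSeminorm_apply {V W : Type*} [AddCommGroup V] [Module ℂ V]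
    [AddCommGroup W] [Module ℂ W] (p : Seminorm ℂ V) (q : Seminorm ℂ W) (u : InjTensor V W) :
    injSeminorm p q u = ⨆ z : p.dualBall × q.dualBall,
      ‖InjTensor.form (z.1 : V →ₗ[ℂ] ℂ) (z.2 : W →ₗ[ℂ] ℂ) u‖ :=
  Seminorm.iSup_apply (injSeminorm_bddAbove p q)

/-- The seminorms generating the injective topology (uniform convergence on products of
equicontinuous subsets of the duals of `V` and `W`). -/
def injSeminorms :
    SeminormFamily ℂ (InjTensor V W)
      ({p : Seminorm ℂ V // Continuous p} × {q : Seminorm ℂ W // Continuous q}) :=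
  fun i => injSeminorm i.1.1 i.2.1

instance : UniformSpace (InjTensor V W) := seminormUniformSpace (injSeminorms V W)

instance : IsUniformAddGroup (InjTensor V W) :=
  seminormUniformSpace_isUniformAddGroup (injSeminorms V W)

theorem InjTensor.withSeminorms : WithSeminorms (injSeminorms V W) :=
  seminormUniformSpace_withSeminorms (injSeminorms V W)

instance : ContinuousSMul ℂ (InjTensor V W) := (InjTensor.withSeminorms V W).continuousSMul

instance : UniformContinuousConstSMul ℂ (InjTensor V W) :=
  uniformContinuousConstSMul_of_continuousConstSMul ℂ _

/-- The completed injective tensor product `V ⊗̂_ε W`. -/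
abbrev CompletedInjTensor : Type _ := Completion (InjTensor V W)

variable {V W} in
/-- The element `v ⊗ w` of `V ⊗̂_ε W`. -/
def CompletedInjTensor.tmul (v : V) (w : W) : CompletedInjTensor V W :=
  ((InjTensor.mk V W v w : InjTensor V W) : Completion (InjTensor V W))

end Injective

/-! ### Nuclear spaces -/

section Nuclear

variable {V : Type*} [AddCommGroup V] [Module ℂ V]

/-- The vector space `V` endowed with the seminorm `p`. -/
def SeminormedCopy (_p : Seminorm ℂ V) : Type _ := V

instance (p : Seminorm ℂ V) : SeminormedAddCommGroup (SeminormedCopy p) :=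
  p.toSeminormedAddCommGroup

instance (p : Seminorm ℂ V) : Module ℂ (SeminormedCopy p) := inferInstanceAs (Module ℂ V)

instance (p : Seminorm ℂ V) : NormedSpace ℂ (SeminormedCopy p) where
  norm_smul_le a x := (map_smul_eq_mul p a (x : V)).le

/-- The local Banach space of `V` at `p`: the Hausdorff completion of `(V, p)`. -/
abbrev LocalBanach (p : Seminorm ℂ V) : Type _ := Completion (SeminormedCopy p)

/-- The canonical map from `V` to its local Banach space at `p`. -/
def toLocalBanach (p : Seminorm ℂ V) : V →ₗ[ℂ] LocalBanach p where
  toFun v := ((show SeminormedCopy p from v) : Completion (SeminormedCopy p))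
  map_add' v w := Completion.coe_add (show SeminormedCopy p from v) (show SeminormedCopy p from w)
  map_smul' c v := Completion.coe_smul c (show SeminormedCopy p from v)

/-- A linear map `A` from a locally convex space `V` into a Banach space `B` is nuclear if
`A v = ∑ k, c k * f k v • b k` for an absolutely summable sequence `c` of scalars, an
equicontinuous sequence `f` of linear forms and a bounded sequence `b` in `B`. -/
def IsNuclearMap [TopologicalSpace V] {B : Type*} [NormedAddCommGroup B] [NormedSpace ℂ B]
    (A : V →ₗ[ℂ] B) : Prop :=
  ∃ (c : ℕ → ℂ) (f : ℕ → V →ₗ[ℂ] ℂ) (b : ℕ → B) (q : Seminorm ℂ V) (M : ℝ),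
    Summable (fun k => ‖c k‖) ∧
    Continuous q ∧ (∀ k, f k ∈ q.dualBall) ∧
    (∀ k, ‖b k‖ ≤ M) ∧
    ∀ v, HasSum (fun k => (c k * f k v) • b k) (A v)

variable (V) in
/-- A locally convex space is nuclear if the canonical map into each of its local Banach spaces is
nuclear. -/
def IsNuclearSpace [TopologicalSpace V] : Prop :=
  ∀ p : Seminorm ℂ V, Continuous p → IsNuclearMap (toLocalBanach p)

end Nuclear

/-! ### Spaces of distributions -/

section Distributions

variable {X : Type*} [NormedAddCommGroup X] [NormedSpace ℝ X]
  {Y : Type*} [NormedAddCommGroup Y] [NormedSpace ℝ Y]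

variable (X) in
/-- The space `𝓓'(X)` of complex-valued distributions on `X`. -/
abbrev Distr : Type _ := 𝓓'((⊤ : Opens X), ℂ)

/-- The vector space underlying a subspace of `𝓓'(X)`, without the subspace topology. -/
def BareSubspace (M : Submodule ℂ (Distr X)) : Type _ := M

instance (M : Submodule ℂ (Distr X)) : AddCommGroup (BareSubspace M) :=
  inferInstanceAs (AddCommGroup M)

instance (M : Submodule ℂ (Distr X)) : Module ℂ (BareSubspace M) :=
  inferInstanceAs (Module ℂ M)

/-- The inclusion of a subspace of `𝓓'(X)` into `𝓓'(X)`. -/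
def BareSubspace.incl (M : Submodule ℂ (Distr X)) : BareSubspace M →ₗ[ℂ] Distr X := M.subtype

variable (X) in
/-- A space of distributions on `X`: a linear subspace of `𝓓'(X)` endowed with a locally convex
topology which is finer than the one induced by `𝓓'(X)`. -/
structure DistributionSpace where
  /-- The underlying subspace of `𝓓'(X)`. -/
  toSubmodule : Submodule ℂ (Distr X)
  [uniformSpace : UniformSpace (BareSubspace toSubmodule)]
  [isUniformAddGroup : IsUniformAddGroup (BareSubspace toSubmodule)]
  [continuousSMul : ContinuousSMul ℂ (BareSubspace toSubmodule)]
  [locallyConvexSpace : LocallyConvexSpace ℝ (BareSubspace toSubmodule)]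
  continuous_incl : Continuous (BareSubspace.incl toSubmodule)

namespace DistributionSpace

/-- A space of distributions, as a locally convex space. -/
instance : CoeSort (DistributionSpace X) (Type _) := ⟨fun E => BareSubspace E.toSubmodule⟩

instance (E : DistributionSpace X) : UniformSpace E := E.uniformSpace
instance (E : DistributionSpace X) : IsUniformAddGroup E := E.isUniformAddGroup
instance (E : DistributionSpace X) : ContinuousSMul ℂ E := E.continuousSMul
instance (E : DistributionSpace X) : LocallyConvexSpace ℝ E := E.locallyConvexSpace

/-- The continuous inclusion of a space of distributions into `𝓓'(X)`. -/
def incl (E : DistributionSpace X) : E →L[ℂ] Distr X :=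
  ⟨BareSubspace.incl E.toSubmodule, E.continuous_incl⟩

/-- `E ↪ F`: the space `E` is contained in `F`, and the inclusion is continuous. -/
def ContinuouslyIncludedIn (E F : DistributionSpace X) : Prop :=
  ∃ ι : E →L[ℂ] F, ∀ S : E, F.incl (ι S) = E.incl S

end DistributionSpace

/-- The test function `(x, y) ↦ φ x * ψ y`. -/
def TestFunction.tensor (φ : 𝓓((⊤ : Opens X), ℝ)) (ψ : 𝓓((⊤ : Opens Y), ℝ)) :
    𝓓((⊤ : Opens (X × Y)), ℝ) where
  toFun z := φ z.1 * ψ z.2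
  contDiff' := (φ.contDiff.comp contDiff_fst).mul (ψ.contDiff.comp contDiff_snd)
  hasCompactSupport' := by
    refine HasCompactSupport.intro (φ.hasCompactSupport.isCompact.prod
      ψ.hasCompactSupport.isCompact) ?_
    rintro ⟨x, y⟩ h
    by_cases hx : x ∈ tsupport φ
    · have hy : y ∉ tsupport ψ := fun hy => h ⟨hx, hy⟩
      simp [image_eq_zero_of_notMem_tsupport hy]
    · simp [image_eq_zero_of_notMem_tsupport hx]
  tsupport_subset' := fun _ _ => trivial

/-- `W ∈ 𝓓'(X × Y)` is the tensor product `S ⊗ T` of `S ∈ 𝓓'(X)` and `T ∈ 𝓓'(Y)`, i.e. the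
distribution characterised by `W (φ ⊗ ψ) = S φ * T ψ` for all test functions `φ` and `ψ`. -/
def IsDistrTensor (S : Distr X) (T : Distr Y) (W : Distr (X × Y)) : Prop :=
  ∀ (φ : 𝓓((⊤ : Opens X), ℝ)) (ψ : 𝓓((⊤ : Opens Y), ℝ)), W (φ.tensor ψ) = S φ * T ψ

namespace DistributionSpace

/-- The tensor product of distributions `(S, T) ↦ S ⊗ T` is a well-defined and (jointly)
continuous bilinear map `E × F → G`. -/
def TensorContinuous (E : DistributionSpace X) (F : DistributionSpace Y)
    (G : DistributionSpace (X × Y)) : Prop :=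
  ∃ m : E →ₗ[ℂ] F →ₗ[ℂ] G,
    (∀ (S : E) (T : F), IsDistrTensor (E.incl S) (F.incl T) (G.incl (m S T))) ∧
    Continuous fun z : E × F => m z.1 z.2

/-- `E ⊗̂_ε F ≅ G` via the tensor product of distributions: there is an isomorphism of topological
vector spaces `E ⊗̂_ε F ≃ G` which sends each `S ⊗ T` to the distribution `S ⊗ T`. -/
def InjTensorIso (E : DistributionSpace X) (F : DistributionSpace Y)
    (G : DistributionSpace (X × Y)) : Prop :=
  ∃ J : CompletedInjTensor E F ≃L[ℂ] G,
    ∀ (S : E) (T : F),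
      IsDistrTensor (E.incl S) (F.incl T) (G.incl (J (CompletedInjTensor.tmul S T)))

/-- `E ⊗̂_π F ↪ G` via the tensor product of distributions: there is a continuous linear injection
`E ⊗̂_π F → G` which sends each `S ⊗ T` to the distribution `S ⊗ T`. -/
def ProjTensorEmbeds (E : DistributionSpace X) (F : DistributionSpace Y)
    (G : DistributionSpace (X × Y)) : Prop :=
  ∃ J : CompletedProjTensor E F →L[ℂ] G,
    Function.Injective J ∧
    ∀ (S : E) (T : F),
      IsDistrTensor (E.incl S) (F.incl T) (G.incl (J (CompletedProjTensor.tmul S T)))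

end DistributionSpace

end Distributions

end

/-!
The map `J : L ⊗̂_π E → E₂` is the extension of the continuous bilinear map `(S, T) ↦ S ⊗ T`, where
`S ∈ L` is regarded as an element of `E`; it exists because `E₂` is complete and Hausdorff
(`CompletedProjTensor.lift`). The point is its injectivity.

Let `J u = 0`. Testing the distribution `J u` against `φ ⊗ ψ` shows that the extension of
`S ⊗ T ↦ S φ * T ψ` to `L ⊗̂_π E` kills `u`, for all test functions `φ` and `ψ`. This extension
factors through the slice maps `id ⊗ ψ : L ⊗̂_π E → L` and `f ⊗ id : L ⊗̂_π E → E`, with `f ∈ L'`,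
which exist because `L` and `E` are complete. As distributions are separated by test functions,
`(id ⊗ ψ) u = 0` for every `ψ`; hence `ψ ((f ⊗ id) u) = f ((id ⊗ ψ) u) = 0` for all `f ∈ L'` and
`ψ`, and therefore `(f ⊗ id) u = 0` for every `f ∈ L'`
(`DistributionSpace.eq_zero_of_forall_evalCLM_sliceRight_eq_zero`).

Nuclearity of `L` then forces `u = 0` (`CompletedProjTensor.eq_zero_of_sliceLeft_eq_zero`). If `r` is
a seminorm on `L ⊗ E` with `r (S ⊗ T) ≤ p S * q T`, and `∑ k, c k * f k S • b k` is a nuclear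
expansion of `L → L_p`, with `‖b k‖ ≤ M`, then `r t ≤ ∑ k, ‖c k‖ * M * q ((f k ⊗ id) t)`
(`ProjTensor.seminorm_le_tsum_sliceLeft`). When `t` tends to `u`, each term tends to `0`, and the
sequence `f` being equicontinuous, the series is dominated; so `r t` tends to `0` for every `r`.
-/

open scoped Topology

/-! ### Seminorms on locally convex spaces and their tensor products -/

@[elab_as_elim]
theorem ProjTensor.induction_on {V W : Type*} [AddCommGroup V] [Module ℂ V] [AddCommGroup W]
    [Module ℂ W] {motive : ProjTensor V W → Prop} (t : ProjTensor V W)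
    (mk : ∀ v w, motive (ProjTensor.mk V W v w))
    (add : ∀ x y, motive x → motive y → motive (x + y)) : motive t :=
  TensorProduct.induction_on t (map_zero (ProjTensor.mk V W 0) ▸ mk 0 0) mk add

section LocallyConvex

/-- A locally convex complex vector space is topologized by its continuous complex seminorms.
Mathlib's version of this fact requires neighbourhood bases of sets that are convex over `ℂ`
(for the partial order on `ℂ`), which are the same as those convex over `ℝ`. -/
theorem polynormableSpace_complex_of_locallyConvexSpace_real {V : Type*} [AddCommGroup V]
    [Module ℂ V] [TopologicalSpace V] [IsTopologicalAddGroup V] [ContinuousSMul ℂ V]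
    [LocallyConvexSpace ℝ V] : PolynormableSpace ℂ V := by
  open scoped ComplexOrder in
  have : LocallyConvexSpace ℂ V := by
    rw [locallyConvexSpace_iff_exists_convex_subset_zero]
    intro U hU
    obtain ⟨S, hS, hSc, hSU⟩ :=
      (locallyConvexSpace_iff_exists_convex_subset_zero ℝ V).1 inferInstance U hU
    exact ⟨S, hS, convex_RCLike_iff_convex_real.2 hSc, hSU⟩
  have : ContinuousSMul ℝ V := IsScalarTower.continuousSMul ℂ
  infer_instance

variable {V : Type*} [AddCommGroup V] [Module ℂ V] [TopologicalSpace V] [PolynormableSpace ℂ V]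

theorem PolynormableSpace.exists_seminorm_ball_subset {U : Set V} (hU : U ∈ 𝓝 (0 : V)) :
    ∃ (p : Seminorm ℂ V) (ε : ℝ), Continuous p ∧ 0 < ε ∧ p.ball 0 ε ⊆ U := by
  obtain ⟨⟨s, ε⟩, hε, hs⟩ := (PolynormableSpace.withSeminorms ℂ V).hasBasis_zero_ball.mem_iff.1 hU
  have := (PolynormableSpace.withSeminorms ℂ V).topologicalAddGroup
  exact ⟨_, ε, Seminorm.continuous_finsetSup fun i _ => i.2, hε, hs⟩

/-- On `V ⊗ W`, every seminorm continuous on elementary tensors is dominated there by a product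
of continuous seminorms. -/
theorem exists_seminorms_forall_tmul_le {W : Type*} [AddCommGroup W] [Module ℂ W]
    [TopologicalSpace W] [PolynormableSpace ℂ W] (r : Seminorm ℂ (ProjTensor V W))
    (hr : Continuous fun z : V × W => r (ProjTensor.mk V W z.1 z.2)) :
    ∃ (p : Seminorm ℂ V) (q : Seminorm ℂ W), Continuous p ∧ Continuous q ∧
      ∀ v w, r (ProjTensor.mk V W v w) ≤ p v * q w := by
  have h0 : {z : V × W | r (ProjTensor.mk V W z.1 z.2) < 1} ∈ 𝓝 ((0, 0) : V × W) :=
    (isOpen_lt hr continuous_const).mem_nhds (by simp)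
  rw [nhds_prod_eq, Filter.mem_prod_iff] at h0
  obtain ⟨A, hA, B, hB, hAB⟩ := h0
  obtain ⟨p, ε, hp, hε, hpA⟩ := PolynormableSpace.exists_seminorm_ball_subset hA
  obtain ⟨q, δ, hq, hδ, hqB⟩ := PolynormableSpace.exists_seminorm_ball_subset hB
  lift ε to NNReal using hε.le
  lift δ to NNReal using hδ.le
  refine ⟨ε⁻¹ • p, δ⁻¹ • q,
    hp.const_smul _, hq.const_smul _, fun v w => ?_⟩
  change _ ≤ ((ε : ℝ)⁻¹ * p v) * ((δ : ℝ)⁻¹ * q w)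
  -- Rescaling `v` and `w` into the two balls gives the bound with any `a > p v / ε`, `b > q w / δ`.
  have key : ∀ a > (ε : ℝ)⁻¹ * p v, ∀ b > (δ : ℝ)⁻¹ * q w, r (ProjTensor.mk V W v w) ≤ a * b := by
    intro a ha b hb
    have ha0 : 0 < a := lt_of_le_of_lt (by positivity) ha
    have hb0 : 0 < b := lt_of_le_of_lt (by positivity) hb
    have hv : ((a⁻¹ : ℝ) : ℂ) • v ∈ A := hpA <| by
      rw [Seminorm.mem_ball_zero, map_smul_eq_mul, Complex.norm_real, Real.norm_of_nonneg
        (by positivity), inv_mul_lt_iff₀ ha0]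
      rwa [gt_iff_lt, inv_mul_lt_iff₀ hε, mul_comm] at ha
    have hw : ((b⁻¹ : ℝ) : ℂ) • w ∈ B := hqB <| by
      rw [Seminorm.mem_ball_zero, map_smul_eq_mul, Complex.norm_real, Real.norm_of_nonneg
        (by positivity), inv_mul_lt_iff₀ hb0]
      rwa [gt_iff_lt, inv_mul_lt_iff₀ hδ, mul_comm] at hb
    have h1 : r (ProjTensor.mk V W (((a⁻¹ : ℝ) : ℂ) • v) (((b⁻¹ : ℝ) : ℂ) • w)) < 1 :=
      hAB (Set.mk_mem_prod hv hw)
    rw [LinearMap.map_smul, LinearMap.map_smul, LinearMap.smul_apply, map_smul_eq_mul,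
      map_smul_eq_mul,
      Complex.norm_real, Complex.norm_real, Real.norm_of_nonneg (by positivity),
      Real.norm_of_nonneg (by positivity), inv_mul_lt_iff₀ hb0, inv_mul_lt_iff₀ ha0] at h1
    linarith
  refine ge_of_tendsto (x := 𝓝[>] (0 : ℝ))
    (f := fun t => ((ε : ℝ)⁻¹ * p v + t) * ((δ : ℝ)⁻¹ * q w + t)) ?_ ?_
  · refine Filter.Tendsto.mono_left ?_ nhdsWithin_le_nhds
    exact Continuous.tendsto' (by fun_prop) _ _ (by simp)
  · filter_upwards [self_mem_nhdsWithin] with t ht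
    exact key _ (by simpa using ht) _ (by simpa using ht)

end LocallyConvex

/-! ### The universal property of the completed projective tensor product -/

section Lift

/-- Two linear maps on `V ⊗ W` which agree on elementary tensors agree. -/
theorem ProjTensor.hom_ext {V W G : Type*} [AddCommGroup V] [Module ℂ V] [AddCommGroup W]
    [Module ℂ W] [AddCommGroup G] [Module ℂ G] {f g : ProjTensor V W →ₗ[ℂ] G}
    (h : ∀ v w, f (ProjTensor.mk V W v w) = g (ProjTensor.mk V W v w)) : f = g :=
  TensorProduct.ext' h

variable {V W G : Type*} [AddCommGroup V] [Module ℂ V] [TopologicalSpace V]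
  [AddCommGroup W] [Module ℂ W] [TopologicalSpace W]
  [AddCommGroup G] [Module ℂ G]

theorem ProjTensor.continuous_of_continuous_mk [TopologicalSpace G] [PolynormableSpace ℂ G]
    (f : ProjTensor V W →ₗ[ℂ] G)
    (hf : Continuous fun z : V × W => f (ProjTensor.mk V W z.1 z.2)) : Continuous f :=
  (PolynormableSpace.withSeminorms ℂ G).continuous_of_continuous_comp f fun i =>
    (ProjTensor.withSeminorms V W).continuous_seminorm ⟨i.1.comp f, i.2.comp hf⟩

namespace CompletedProjTensor

variable (V W) in
/-- The canonical map `V ⊗_π W → V ⊗̂_π W`. -/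
def coeL : ProjTensor V W →L[ℂ] CompletedProjTensor V W where
  toFun t := (t : Completion (ProjTensor V W))
  map_add' := Completion.coe_add
  map_smul' := Completion.coe_smul
  cont := Completion.continuous_coe _

theorem denseRange_coeL : DenseRange (coeL V W) := Completion.denseRange_coe

theorem isUniformInducing_coeL : IsUniformInducing (coeL V W) :=
  Completion.isUniformInducing_coe _

theorem clm_ext [TopologicalSpace G] [T2Space G] {f g : CompletedProjTensor V W →L[ℂ] G}
    (h : ∀ v w, f (tmul v w) = g (tmul v w)) : f = g := by
  have h' : (f ∘L coeL V W).toLinearMap = (g ∘L coeL V W).toLinearMap := ProjTensor.hom_ext h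
  refine ContinuousLinearMap.coeFn_injective <|
    denseRange_coeL.equalizer f.continuous g.continuous ?_
  exact congrArg DFunLike.coe h'

variable [UniformSpace G] [IsUniformAddGroup G] [ContinuousSMul ℂ G] [T2Space G]
  [CompleteSpace G] [PolynormableSpace ℂ G]

/-- The continuous linear map `V ⊗̂_π W → G` induced by a jointly continuous bilinear map
`V × W → G` into a complete Hausdorff locally convex space. -/
noncomputable def lift (B : V →ₗ[ℂ] W →ₗ[ℂ] G) (hB : Continuous fun z : V × W => B z.1 z.2) :
    CompletedProjTensor V W →L[ℂ] G :=
  ContinuousLinearMap.extend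
    (⟨(TensorProduct.lift B : ProjTensor V W →ₗ[ℂ] G),
      ProjTensor.continuous_of_continuous_mk _ hB⟩ : ProjTensor V W →L[ℂ] G) (coeL V W)

theorem lift_coe (B : V →ₗ[ℂ] W →ₗ[ℂ] G) (hB : Continuous fun z : V × W => B z.1 z.2)
    (t : ProjTensor V W) :
    lift B hB (t : Completion (ProjTensor V W)) =
      (TensorProduct.lift B : ProjTensor V W →ₗ[ℂ] G) t :=
  ContinuousLinearMap.extend_eq _ denseRange_coeL isUniformInducing_coeL t

theorem lift_tmul (B : V →ₗ[ℂ] W →ₗ[ℂ] G) (hB : Continuous fun z : V × W => B z.1 z.2)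
    (v : V) (w : W) : lift B hB (tmul v w) = B v w :=
  lift_coe B hB _

end CompletedProjTensor

end Lift

/-! ### Slice maps -/

section Slice

variable {V W : Type*} [AddCommGroup V] [Module ℂ V] [AddCommGroup W] [Module ℂ W]

/-- The slice map `f ⊗ id : V ⊗ W → W`, `v ⊗ w ↦ f v • w`, of a linear form `f` on `V`. -/
noncomputable def ProjTensor.sliceLeft (f : V →ₗ[ℂ] ℂ) : ProjTensor V W →ₗ[ℂ] W :=
  TensorProduct.lift (LinearMap.lsmul ℂ W ∘ₗ f)

theorem ProjTensor.sliceLeft_mk (f : V →ₗ[ℂ] ℂ) (v : V) (w : W) :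
    ProjTensor.sliceLeft f (ProjTensor.mk V W v w) = f v • w := rfl

namespace CompletedProjTensor

section Left

variable [TopologicalSpace V] [UniformSpace W] [IsUniformAddGroup W] [ContinuousSMul ℂ W]
  [CompleteSpace W] [T2Space W] [PolynormableSpace ℂ W]

/-- The slice map `f ⊗ id : V ⊗̂_π W → W` of a continuous linear form `f` on `V`. -/
noncomputable def sliceLeft (f : V →L[ℂ] ℂ) : CompletedProjTensor V W →L[ℂ] W :=
  lift (LinearMap.lsmul ℂ W ∘ₗ f.toLinearMap)
    ((f.continuous.comp continuous_fst).smul continuous_snd)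

theorem sliceLeft_tmul (f : V →L[ℂ] ℂ) (v : V) (w : W) : sliceLeft f (tmul v w) = f v • w :=
  lift_tmul _ _ v w

theorem sliceLeft_coe (f : V →L[ℂ] ℂ) (t : ProjTensor V W) :
    sliceLeft f (t : Completion (ProjTensor V W)) = ProjTensor.sliceLeft f.toLinearMap t :=
  lift_coe _ _ t

end Left

section Right

variable [UniformSpace V] [IsUniformAddGroup V] [ContinuousSMul ℂ V]
  [CompleteSpace V] [T2Space V] [PolynormableSpace ℂ V] [TopologicalSpace W]

/-- The slice map `id ⊗ g : V ⊗̂_π W → V` of a continuous linear form `g` on `W`. -/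
noncomputable def sliceRight (g : W →L[ℂ] ℂ) : CompletedProjTensor V W →L[ℂ] V :=
  lift (LinearMap.lsmul ℂ V ∘ₗ g.toLinearMap).flip
    ((g.continuous.comp continuous_snd).smul continuous_fst)

theorem sliceRight_tmul (g : W →L[ℂ] ℂ) (v : V) (w : W) : sliceRight g (tmul v w) = g w • v :=
  lift_tmul _ _ v w

end Right

theorem apply_sliceLeft_eq_apply_sliceRight [UniformSpace V] [IsUniformAddGroup V]
    [ContinuousSMul ℂ V] [UniformSpace W] [IsUniformAddGroup W] [ContinuousSMul ℂ W]
    [CompleteSpace V] [T2Space V] [PolynormableSpace ℂ V]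
    [CompleteSpace W] [T2Space W] [PolynormableSpace ℂ W] (f : V →L[ℂ] ℂ) (g : W →L[ℂ] ℂ)
    (u : CompletedProjTensor V W) : g (sliceLeft f u) = f (sliceRight g u) := by
  have : g ∘L sliceLeft f = f ∘L sliceRight g := clm_ext fun v w => by
    simp [sliceLeft_tmul, sliceRight_tmul, mul_comm]
  exact congrArg (· u) this

end CompletedProjTensor

end Slice

/-! ### Nuclearity -/

section NuclearEstimate

variable {V W : Type*} [AddCommGroup V] [Module ℂ V] [AddCommGroup W] [Module ℂ W]

/-- The slices of `t` along an equicontinuous sequence of linear forms are bounded by a seminorm of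
`t` which is continuous for the projective topology, namely by `s = ⨆ k, q ∘ (f k ⊗ id)`: on
elementary tensors, `s (v ⊗ w) = (⨆ k, ‖f k v‖) * q w`. -/
theorem ProjTensor.exists_seminorm_sliceLeft_le [TopologicalSpace V] [IsTopologicalAddGroup V]
    [TopologicalSpace W]
    {f : ℕ → V →ₗ[ℂ] ℂ} {p : Seminorm ℂ V} (hp : Continuous p)
    (hf : ∀ k, f k ∈ p.dualBall) {q : Seminorm ℂ W} (hq : Continuous q) :
    ∃ s : Seminorm ℂ (ProjTensor V W), Continuous s ∧
      ∀ k t, q (ProjTensor.sliceLeft (f k) t) ≤ s t := by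
  let σ : ℕ → Seminorm ℂ (ProjTensor V W) := fun k => q.comp (ProjTensor.sliceLeft (f k))
  let φ : ℕ → Seminorm ℂ V := fun k => (normSeminorm ℂ ℂ).comp (f k)
  have hφ : BddAbove (Set.range φ) := ⟨p, by rintro _ ⟨k, rfl⟩; exact hf k⟩
  have hσ : BddAbove (Set.range σ) := by
    rw [Seminorm.bddAbove_range_iff]
    intro t
    induction t using ProjTensor.induction_on with
    | mk v w =>
      refine ⟨p v * q w, ?_⟩
      rintro _ ⟨k, rfl⟩
      change q (ProjTensor.sliceLeft (f k) (ProjTensor.mk V W v w)) ≤ _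
      rw [ProjTensor.sliceLeft_mk, map_smul_eq_mul]
      exact mul_le_mul_of_nonneg_right (hf k v) (apply_nonneg q w)
    | add a b ha hb =>
      obtain ⟨A, hA⟩ := ha
      obtain ⟨B, hB⟩ := hb
      refine ⟨A + B, ?_⟩
      rintro _ ⟨k, rfl⟩
      exact (map_add_le_add (σ k) a b).trans (add_le_add (hA ⟨k, rfl⟩) (hB ⟨k, rfl⟩))
  have hφc : Continuous (⨆ k, φ k : Seminorm ℂ V) :=
    Seminorm.continuous_of_le hp (ciSup_le fun k => hf k)
  have hσc : Continuous fun z : V × W => (⨆ k, σ k) (ProjTensor.mk V W z.1 z.2) := by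
    have : (fun z : V × W => (⨆ k, σ k) (ProjTensor.mk V W z.1 z.2)) =
        fun z => (⨆ k, φ k) z.1 * q z.2 := by
      funext z
      rw [Seminorm.iSup_apply hσ, Seminorm.iSup_apply hφ,
        Real.iSup_mul_of_nonneg (apply_nonneg q z.2)]
      refine iSup_congr fun k => ?_
      change q (ProjTensor.sliceLeft (f k) (ProjTensor.mk V W z.1 z.2)) = ‖f k z.1‖ * q z.2
      rw [ProjTensor.sliceLeft_mk, map_smul_eq_mul]
    rw [this]
    exact (hφc.comp continuous_fst).mul (hq.comp continuous_snd)
  refine ⟨⨆ k, σ k, (ProjTensor.withSeminorms V W).continuous_seminorm ⟨_, hσc⟩, fun k t => ?_⟩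
  exact le_ciSup hσ k t

/-- The estimate behind the coincidence of the projective and injective topologies for nuclear `V`:
a seminorm `r` with `r (v ⊗ w) ≤ p v * q w` extends to the local Banach space `V_p`, so a nuclear
expansion of `V → V_p` expands `r t` in the slices of `t`. -/
theorem ProjTensor.seminorm_le_tsum_sliceLeft (r : Seminorm ℂ (ProjTensor V W))
    {p : Seminorm ℂ V} {q : Seminorm ℂ W}
    (hr : ∀ v w, r (ProjTensor.mk V W v w) ≤ p v * q w)
    {c : ℕ → ℂ} {f : ℕ → V →ₗ[ℂ] ℂ} {b : ℕ → LocalBanach p} {M : ℝ} (hb : ∀ k, ‖b k‖ ≤ M)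
    (hsum : ∀ v, HasSum (fun k => (c k * f k v) • b k) (toLocalBanach p v))
    (t : ProjTensor V W) (hs : Summable fun k => ‖c k‖ * M * q (ProjTensor.sliceLeft (f k) t)) :
    r t ≤ ∑' k, ‖c k‖ * M * q (ProjTensor.sliceLeft (f k) t) := by
  let R := LocalBanach r
  -- the bilinear map `V × W → (V ⊗ W)_r`, as a bounded map on `(V, p) × (W, q)`
  let B₀ : SeminormedCopy p →L[ℂ] SeminormedCopy q →L[ℂ] R :=
    LinearMap.mkContinuous₂ ((ProjTensor.mk V W).compr₂ (toLocalBanach r)) 1 fun v w => by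
      rw [one_mul]
      exact (Completion.norm_coe (E := SeminormedCopy r) _).trans_le (hr v w)
  have hB₀ : ‖B₀‖ ≤ 1 := LinearMap.mkContinuous₂_norm_le _ zero_le_one _
  let e : SeminormedCopy p →L[ℂ] LocalBanach p := Completion.toComplL
  have he : DenseRange e := Completion.denseRange_coe
  have hei : IsUniformInducing e := Completion.isUniformInducing_coe _
  let B : LocalBanach p →L[ℂ] SeminormedCopy q →L[ℂ] R := B₀.extend e
  have hBe : ∀ v : V, B (toLocalBanach p v) = B₀ v := fun v => B₀.extend_eq he hei v
  have hB : ∀ x, ‖B x‖ ≤ ‖x‖ := fun x => by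
    induction x using Completion.induction_on with
    | hp => exact isClosed_le (by fun_prop) (by fun_prop)
    | ih v =>
      have : B (v : LocalBanach p) = B₀ v := hBe v
      rw [this, Completion.norm_coe]
      simpa using B₀.le_of_opNorm_le hB₀ v
  -- the slice maps, with values in `W` normed by `q`
  let σ : ℕ → ProjTensor V W →ₗ[ℂ] SeminormedCopy q := fun k =>
    (LinearMap.id : W →ₗ[ℂ] W) ∘ₗ ProjTensor.sliceLeft (f k)
  have hexp : HasSum (fun k => c k • B (b k) (σ k t)) (toLocalBanach r t) := by
    -- by linearity in `t`, it suffices to expand elementary tensors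
    clear hs
    induction t using ProjTensor.induction_on with
    | mk v w =>
      let w' : SeminormedCopy q := w
      have h := (B.flip w').hasSum (hsum v)
      have h1 : B.flip w' (toLocalBanach p v) = toLocalBanach r (ProjTensor.mk V W v w) := by
        change B (toLocalBanach p v) w' = _
        rw [hBe]
        rfl
      rw [h1] at h
      refine h.congr_fun fun k => ?_
      change c k • B (b k) (f k v • w') = B.flip w' ((c k * f k v) • b k)
      rw [map_smul, map_smul, smul_smul, ContinuousLinearMap.flip_apply]
    | add x y hx hy =>
      rw [map_add]
      refine (hx.add hy).congr_fun fun k => ?_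
      rw [map_add, map_add, smul_add]
  have hnorm : ∀ k, ‖c k • B (b k) (σ k t)‖ ≤
      ‖c k‖ * M * q (ProjTensor.sliceLeft (f k) t) := fun k => by
    rw [norm_smul, mul_assoc]
    gcongr
    refine ((B (b k)).le_opNorm _).trans ?_
    exact mul_le_mul_of_nonneg_right ((hB _).trans (hb k)) (apply_nonneg q _)
  calc r t = ‖toLocalBanach r t‖ := (Completion.norm_coe (E := SeminormedCopy r) t).symm
    _ ≤ _ := hexp.tsum_eq ▸ tsum_of_norm_bounded hs.hasSum hnorm

theorem continuous_of_mem_dualBall [TopologicalSpace V] [IsTopologicalAddGroup V]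
    {p : Seminorm ℂ V} (hp : Continuous p) {f : V →ₗ[ℂ] ℂ} (hf : f ∈ p.dualBall) : Continuous f :=
  (norm_withSeminorms ℂ ℂ).continuous_of_continuous_comp f fun _ => Seminorm.continuous_of_le hp hf

end NuclearEstimate

/-- An element of `V ⊗̂_π W`, with `V` nuclear, is determined by its slices along the continuous
linear forms on `V`. -/
theorem CompletedProjTensor.eq_zero_of_sliceLeft_eq_zero {V W : Type*} [AddCommGroup V] [Module ℂ V]
    [UniformSpace V] [IsUniformAddGroup V] [ContinuousSMul ℂ V] [PolynormableSpace ℂ V]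
    [AddCommGroup W] [Module ℂ W] [UniformSpace W] [IsUniformAddGroup W] [ContinuousSMul ℂ W]
    [PolynormableSpace ℂ W] [CompleteSpace W] [T2Space W] (hV : IsNuclearSpace V)
    {u : CompletedProjTensor V W} (hu : ∀ f : V →L[ℂ] ℂ, sliceLeft f u = 0) : u = 0 := by
  let l : Filter (ProjTensor V W) := Filter.comap (↑) (𝓝 u)
  have hl : l.NeBot := Completion.isDenseInducing_coe.comap_nhds_neBot u
  have hlu : Filter.Tendsto (fun t : ProjTensor V W => (t : Completion (ProjTensor V W))) l (𝓝 u) :=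
    Filter.tendsto_comap
  -- elements of `V ⊗ W` converging to `u` converge to `0`
  suffices h : Filter.Tendsto id l (𝓝 0) from
    tendsto_nhds_unique hlu (((Completion.continuous_coe _).tendsto' 0 0 Completion.coe_zero).comp h)
  rw [(ProjTensor.withSeminorms V W).tendsto_nhds]
  rintro ⟨r, hr⟩ ε hε
  obtain ⟨p, q, hp, hq, hpq⟩ := exists_seminorms_forall_tmul_le r hr
  obtain ⟨c, f, b, p', M, hc, hp', hf, hb, hsum⟩ := hV p hp
  obtain ⟨s, hs, hsf⟩ := ProjTensor.exists_seminorm_sliceLeft_le hp' hf hq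
  have hM : 0 ≤ M := (norm_nonneg _).trans (hb 0)
  -- `s` is bounded near `u`, which provides the dominating series
  obtain ⟨K, hK⟩ : ∃ K, ∀ᶠ t in l, s t ≤ K := by
    have hsu : UniformContinuous s := Seminorm.uniformContinuous_of_continuousAt_zero hs.continuousAt
    have hlim : Filter.Tendsto s l (𝓝 (Completion.extension s u)) :=
      ((Completion.continuous_extension.tendsto u).comp hlu).congr fun t =>
        Completion.extension_coe hsu t
    exact ⟨_, (hlim.eventually (gt_mem_nhds (lt_add_one _))).mono fun _ h => h.le⟩
  have hdom : ∀ᶠ t in l, ∀ k,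
      ‖‖c k‖ * M * q (ProjTensor.sliceLeft (f k) t)‖ ≤ ‖c k‖ * M * K := by
    filter_upwards [hK] with t ht k
    rw [Real.norm_of_nonneg (by positivity)]
    gcongr
    exact (hsf k t).trans ht
  have hsumK : Summable fun k => ‖c k‖ * M * K := (hc.mul_right M).mul_right K
  have hslice : ∀ k, Filter.Tendsto
      (fun t => ‖c k‖ * M * q (ProjTensor.sliceLeft (f k) t)) l (𝓝 0) := by
    intro k
    let F : V →L[ℂ] ℂ := ⟨f k, continuous_of_mem_dualBall hp' (hf k)⟩
    have h : Filter.Tendsto (fun t : ProjTensor V W => q (sliceLeft F (t : Completion _))) l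
        (𝓝 (q (sliceLeft F u))) :=
      ((hq.comp (sliceLeft F).continuous).tendsto u).comp hlu
    rw [hu F, map_zero] at h
    simpa [sliceLeft_coe] using h.const_mul (‖c k‖ * M)
  have htend := tendsto_tsum_of_dominated_convergence hsumK hslice hdom
  rw [tsum_zero] at htend
  filter_upwards [hdom, htend.eventually (gt_mem_nhds hε)] with t ht htε
  rw [id, sub_zero]
  exact (ProjTensor.seminorm_le_tsum_sliceLeft r hpq hb hsum t
    (hsumK.of_norm_bounded ht)).trans_lt htε

/-! ### Evaluation at test functions -/

namespace DistributionSpace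

variable {X : Type*} [NormedAddCommGroup X] [NormedSpace ℝ X]

instance (E : DistributionSpace X) : PolynormableSpace ℂ E :=
  polynormableSpace_complex_of_locallyConvexSpace_real

/-- Evaluation at a test function, as a continuous linear form on a space of distributions. -/
noncomputable def evalCLM (E : DistributionSpace X) (φ : 𝓓((⊤ : Opens X), ℝ)) : E →L[ℂ] ℂ where
  toFun S := E.incl S φ
  map_add' S T := by rw [map_add]; rfl
  map_smul' a S := by rw [map_smul]; rfl
  cont := (continuous_eval_const φ).comp E.incl.continuous

theorem evalCLM_apply (E : DistributionSpace X) (φ : 𝓓((⊤ : Opens X), ℝ)) (S : E) :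
    E.evalCLM φ S = E.incl S φ := rfl

theorem eq_zero_of_forall_evalCLM_eq_zero {E : DistributionSpace X} {S : E}
    (h : ∀ φ, E.evalCLM φ S = 0) : S = 0 :=
  Subtype.ext (ContinuousLinearMap.ext h)

instance (E : DistributionSpace X) : T2Space E := by
  refine T2Space.of_injective_continuous
    (f := fun (S : E) (φ : 𝓓((⊤ : Opens X), ℝ)) => E.evalCLM φ S) (fun S T h => ?_)
    (continuous_pi fun φ => (E.evalCLM φ).continuous)
  refine sub_eq_zero.1 (eq_zero_of_forall_evalCLM_eq_zero fun φ => ?_)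
  rw [map_sub, sub_eq_zero]
  exact congrFun h φ

/-- Over a nuclear complete `E`, an element of `E ⊗̂_π F` annihilated by all product forms
`S ⊗ T ↦ S φ * T ψ` vanishes. -/
theorem eq_zero_of_forall_evalCLM_sliceRight_eq_zero {Y : Type*} [NormedAddCommGroup Y]
    [NormedSpace ℝ Y] {E : DistributionSpace X} {F : DistributionSpace Y}
    [CompleteSpace E] [CompleteSpace F] (hE : IsNuclearSpace E) {u : CompletedProjTensor E F}
    (hu : ∀ φ ψ, E.evalCLM φ (CompletedProjTensor.sliceRight (F.evalCLM ψ) u) = 0) : u = 0 := by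
  refine CompletedProjTensor.eq_zero_of_sliceLeft_eq_zero hE fun f => ?_
  refine eq_zero_of_forall_evalCLM_eq_zero fun ψ => ?_
  rw [CompletedProjTensor.apply_sliceLeft_eq_apply_sliceRight,
    eq_zero_of_forall_evalCLM_eq_zero fun φ => hu φ ψ, map_zero]

end DistributionSpace

theorem mainTheorem11 (n : ℕ)
    (L E H : DistributionSpace (EuclideanSpace ℝ (Fin n)))
    (E₂ H₂ : DistributionSpace (EuclideanSpace ℝ (Fin n) × EuclideanSpace ℝ (Fin n)))
    (hLE : L.ContinuouslyIncludedIn E) (hEH : E.ContinuouslyIncludedIn H)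
    (hLnuclear : IsNuclearSpace L) (hLcomplete : CompleteSpace L)
    (hEcomplete : CompleteSpace E) (hE₂complete : CompleteSpace E₂)
    (hE : E.TensorContinuous E E₂)
    (hH : H.InjTensorIso H H₂) :
    L.ProjTensorEmbeds E E₂ := by
  obtain ⟨ι, hι⟩ := hLE
  obtain ⟨m, hm, hmc⟩ := hE
  let J : CompletedProjTensor L E →L[ℂ] E₂ := CompletedProjTensor.lift (m ∘ₗ ι.toLinearMap)
    (hmc.comp ((ι.continuous.comp continuous_fst).prodMk continuous_snd))
  have hJ : ∀ (S : L) (T : E),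
      IsDistrTensor (L.incl S) (E.incl T) (E₂.incl (J (CompletedProjTensor.tmul S T))) :=
    fun S T => by
      rw [CompletedProjTensor.lift_tmul, ← hι S]
      exact hm (ι S) T
  refine ⟨J, (injective_iff_map_eq_zero J).2 fun u hu => ?_, hJ⟩
  refine DistributionSpace.eq_zero_of_forall_evalCLM_sliceRight_eq_zero hLnuclear fun φ ψ => ?_
  -- testing `J u` against `φ ⊗ ψ` computes the product form given by `φ` and `ψ`
  have h : E₂.evalCLM (φ.tensor ψ) ∘L J =
      L.evalCLM φ ∘L CompletedProjTensor.sliceRight (E.evalCLM ψ) :=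
    CompletedProjTensor.clm_ext fun S T => by
      simp only [ContinuousLinearMap.comp_apply, CompletedProjTensor.sliceRight_tmul, map_smul,
        smul_eq_mul, DistributionSpace.evalCLM_apply]
      rw [hJ S T φ ψ, mul_comm]
  rw [← ContinuousLinearMap.comp_apply, ← h, ContinuousLinearMap.comp_apply, hu, map_zero]
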